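/- Let $F$ be a field of characteristic $2$. For a power series $f$ over $F$ in a finite set of variables $x_1,\ldots,x_s$ and $n\ge 0$, let $e_n(f)=\dim_F F[[x_1,\ldots,x_s]]/(x_1^{2^n},\ldots,x_s^{2^n},f)$; the function $n\mapsto e_n(f)$ is the Hilbert-Kunz function of $f$. For a power series $g$ over $F$ in $r$ variables, let $u,v$ be two further variables, view $uv+g$ as a power series in $r+2$ variables, and set $$\theta_g=(1-2^{r+1}w)\sum_{n\ge 0}e_n(uv+g)\,w^n\in\mathbb{Z}[[w]].$$ Let $(g_i)_{i}$ be a finite family of power series over $F$ with zero constant term, where $g_i$ is in $r_i$ variables and the sets of variables belonging to distinct $g_i$ are pairwise disjoint, and view $\sum_i g_i$ as a power series in all $\sum_i r_i$ variables. Then $\theta_{\sum_i g_i}$ is the Hadamard product of the $\theta_{g_i}$; that is, for every $n\ge 0$ the coefficient of $w^n$ in $\theta_{\sum_i g_i}$ is the product over $i$ of the coefficients of $w^n$ in the $\theta_{g_i}$. -/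

import Mathlib

/-- The ideal `(f, x_s ^ (p ^ n) : s ∈ σ)` of the power series ring `F[[x_s : s ∈ σ]]`. -/
noncomputable def hilbertKunzIdeal (p : ℕ) {σ F : Type*} [Field F] (f : MvPowerSeries σ F) (n : ℕ) :
    Ideal (MvPowerSeries σ F) :=
  Ideal.span (insert f (Set.range fun s : σ => (MvPowerSeries.X s : MvPowerSeries σ F) ^ p ^ n))

/-- The Hilbert-Kunz function `n ↦ e_n(f)` of a power series `f` over a field of characteristic `p`:
`e_n(f)` is the `F`-dimension of `F[[x_s : s ∈ σ]] / (f, x_s ^ (p ^ n) : s ∈ σ)`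
(which is finite when there are finitely many variables). -/
noncomputable def hilbertKunz (p : ℕ) {σ F : Type*} [Field F] (f : MvPowerSeries σ F) (n : ℕ) : ℕ :=
  Module.finrank F (MvPowerSeries σ F ⧸ hilbertKunzIdeal p f n)

/-- The power series `u v + g` in the variables of `g` and two new variables
`u = X (inr 0)`, `v = X (inr 1)`. -/
noncomputable def uvAdd {σ F : Type*} [Finite σ] [Field F] (g : MvPowerSeries σ F) :
    MvPowerSeries (σ ⊕ Fin 2) F :=
  MvPowerSeries.X (Sum.inr 0) * MvPowerSeries.X (Sum.inr 1) + MvPowerSeries.rename Sum.inl g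

/-- `θ_g = (1 - 2^(r+1) w) ∑ e_n(u v + g) w^n` in `ℤ[[w]]`, where `r` is the number of variables
of `g`, and `e_n` is the Hilbert-Kunz function in characteristic 2. -/
noncomputable def thetaSeries {σ F : Type*} [Fintype σ] [Field F] (g : MvPowerSeries σ F) :
    PowerSeries ℤ :=
  (1 - PowerSeries.C ((2 : ℤ) ^ (Fintype.card σ + 1)) * PowerSeries.X) *
    PowerSeries.mk fun n => (hilbertKunz 2 (uvAdd g) n : ℤ)

/-- The Hadamard (coefficientwise) product of a finite family of power series. -/
noncomputable def hadamardProd {ι R : Type*} [Fintype ι] [CommSemiring R]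
    (a : ι → PowerSeries R) : PowerSeries R :=
  PowerSeries.mk fun n => ∏ i, PowerSeries.coeff n (a i)

/-- The sum `∑ i, g i` of finitely many power series in pairwise disjoint finite sets of
variables `σ i`, viewed as a power series in the disjoint union of these sets. -/
noncomputable def disjointSum {ι F : Type*} [Fintype ι] {σ : ι → Type*} [∀ i, Finite (σ i)]
    [Field F] (g : ∀ i, MvPowerSeries (σ i) F) : MvPowerSeries (Σ i, σ i) F :=
  ∑ i, MvPowerSeries.rename (Sigma.mk i) (g i)

/-! Put q = 2^n. The number e_n(f) is the corank of multiplication by f on F[[x]]/(x_s^q), an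
operator that is nilpotent when f has zero constant term. For f and g in disjoint variables, f + g
acts on the tensor product of the two truncated rings as f ⊗ 1 + 1 ⊗ g (`tensorSum`). Everything
becomes a question about Jordan types: the coefficient of w^n in θ_g is the number of Jordan blocks
of g of odd size (`coeff_thetaSeries`), and that number is multiplicative under `tensorSum`
(`oddBlocks_tensorSum`).

For the first fact, the corank of S ⊗ 1 + 1 ⊗ T is the sum of min(k, l) over pairs of blocks, that
is, the sum over b of the products of the numbers of blocks larger than b. Multiplication by uv has
2(q - b) - 1 such blocks, so e_n(uv + g) is a weighted sum of the jumps of g. Frobenius relates the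
jumps of g at levels q and 2q, and subtracting 2^(r+1) e_(n-1) leaves the alternating sum of jumps,
which counts odd blocks.

For the second, let J_c be a nilpotent block of size c and write + for `tensorSum`. In
characteristic 2, S + J_c has the corank of S^c, so exponents can be traded for tensor factors. This
reduces multiplicativity to two blocks J_a, J_b with a, b ≤ q. Replacing a by q - a does not change
the number of odd blocks of J_a + J_b, and repeated halving of q brings both sizes down to at most
1. -/

open Polynomial TensorProduct

/-! ### Coranks and the operator T ⊗ 1 + 1 ⊗ S -/

section Corank

variable {F V W V' W' : Type*} [Field F] [AddCommGroup V] [Module F V] [AddCommGroup W] [Module F W]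
  [AddCommGroup V'] [Module F V'] [AddCommGroup W'] [Module F W']

/-- The dimension of the cokernel of an endomorphism. -/
noncomputable def corank (T : Module.End F V) : ℕ :=
  Module.finrank F (V ⧸ LinearMap.range T)

/-- The endomorphism `T ⊗ 1 + 1 ⊗ S` of `V ⊗ W`. -/
noncomputable def tensorSum (T : Module.End F V) (S : Module.End F W) : Module.End F (V ⊗[F] W) :=
  LinearMap.rTensor W T + LinearMap.lTensor V S

@[simp]
theorem tensorSum_tmul (T : Module.End F V) (S : Module.End F W) (v : V) (w : W) :
    tensorSum T S (v ⊗ₜ w) = T v ⊗ₜ w + v ⊗ₜ S w := by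
  simp [tensorSum]

theorem corank_congr (e : V ≃ₗ[F] W) {T : Module.End F V} {S : Module.End F W}
    (h : ∀ v, e (T v) = S (e v)) : corank T = corank S := by
  refine LinearEquiv.finrank_eq (Submodule.Quotient.equiv _ _ e ?_)
  ext w
  simp only [Submodule.mem_map, LinearMap.mem_range]
  constructor
  · rintro ⟨_, ⟨v, rfl⟩, rfl⟩
    exact ⟨e v, (h v).symm⟩
  · rintro ⟨w, rfl⟩
    exact ⟨_, ⟨e.symm w, rfl⟩, by simp [h]⟩

theorem pow_intertwine {e : V →ₗ[F] W} {T : Module.End F V} {S : Module.End F W}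
    (h : ∀ v, e (T v) = S (e v)) (n : ℕ) (v : V) : e ((T ^ n) v) = (S ^ n) (e v) := by
  induction n generalizing v with
  | zero => simp
  | succ n ih => rw [pow_succ, pow_succ, Module.End.mul_apply, Module.End.mul_apply, ih, h]

theorem corank_pow_congr (e : V ≃ₗ[F] W) {T : Module.End F V} {S : Module.End F W}
    (h : ∀ v, e (T v) = S (e v)) (n : ℕ) : corank (T ^ n) = corank (S ^ n) :=
  corank_congr e fun v => pow_intertwine (e := e.toLinearMap) h n v

theorem corank_tensorSum_congr (e : V ≃ₗ[F] V') (f : W ≃ₗ[F] W') {T : Module.End F V}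
    {T' : Module.End F V'} {S : Module.End F W} {S' : Module.End F W'}
    (h : ∀ v, e (T v) = T' (e v)) (h' : ∀ w, f (S w) = S' (f w)) :
    corank (tensorSum T S) = corank (tensorSum T' S') := by
  refine corank_congr (TensorProduct.congr e f) fun v => ?_
  induction v with
  | zero => simp
  | add x y hx hy => simp [hx, hy]
  | tmul x y => simp [h, h']

theorem tensorSum_comm (T : Module.End F V) (S : Module.End F W) (v : V ⊗[F] W) :
    TensorProduct.comm F V W (tensorSum T S v) = tensorSum S T (TensorProduct.comm F V W v) := by
  induction v with
  | zero => simp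
  | add x y hx hy => simp only [map_add, hx, hy]
  | tmul x y => simp [add_comm]

theorem tensorSum_assoc (T : Module.End F V) (S : Module.End F W) (R : Module.End F V')
    (v : (V ⊗[F] W) ⊗[F] V') :
    TensorProduct.assoc F V W V' (tensorSum (tensorSum T S) R v) =
      tensorSum T (tensorSum S R) (TensorProduct.assoc F V W V' v) := by
  induction v with
  | zero => simp
  | add x y hx hy => simp only [map_add, hx, hy]
  | tmul x z =>
    induction x with
    | zero => simp
    | add x y hx hy => simp only [map_add, hx, hy, TensorProduct.add_tmul]
    | tmul x y => simp [add_assoc, TensorProduct.add_tmul, TensorProduct.tmul_add]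

theorem corank_tensorSum_comm (T : Module.End F V) (S : Module.End F W) :
    corank (tensorSum T S) = corank (tensorSum S T) :=
  corank_congr (TensorProduct.comm F V W) (tensorSum_comm T S)

theorem corank_tensorSum_assoc (T : Module.End F V) (S : Module.End F W) (R : Module.End F V') :
    corank (tensorSum (tensorSum T S) R) = corank (tensorSum T (tensorSum S R)) :=
  corank_congr (TensorProduct.assoc F V W V') (tensorSum_assoc T S R)

theorem corank_one : corank (1 : Module.End F V) = 0 := by
  have : LinearMap.range (1 : Module.End F V) = ⊤ := LinearMap.range_id
  rw [corank, this]
  exact Module.finrank_zero_of_subsingleton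

theorem corank_zero : corank (0 : Module.End F V) = Module.finrank F V := by
  rw [corank, LinearMap.range_zero]
  exact (Submodule.quotEquivOfEqBot _ rfl).finrank_eq

theorem corank_pi {ι : Type*} [Fintype ι] {M : ι → Type*} [∀ i, AddCommGroup (M i)]
    [∀ i, Module F (M i)] [∀ i, FiniteDimensional F (M i)] (T : ∀ i, Module.End F (M i)) :
    corank (LinearMap.pi fun i => T i ∘ₗ LinearMap.proj i : Module.End F (∀ i, M i)) =
      ∑ i, corank (T i) := by
  classical
  have h : LinearMap.range (LinearMap.pi fun i => T i ∘ₗ LinearMap.proj i : Module.End F (∀ i, M i))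
      = Submodule.pi Set.univ fun i => LinearMap.range (T i) := by
    ext v
    simp only [LinearMap.mem_range, Submodule.mem_pi, Set.mem_univ, true_imp_iff]
    constructor
    · rintro ⟨w, rfl⟩ i
      exact ⟨w i, rfl⟩
    · intro h
      choose w hw using h
      exact ⟨w, funext hw⟩
  rw [corank, h, (Submodule.quotientPi _).finrank_eq, Module.finrank_pi_fintype]
  rfl

end Corank

/-! ### A single nilpotent block as a tensor factor -/

section Shift

/-- Multiplication by the variable on an `F[X]`-module. -/
noncomputable def mulX (F M : Type*) [Field F] [AddCommGroup M] [Module F M] [Module F[X] M]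
    [IsScalarTower F F[X] M] : Module.End F M :=
  Algebra.lsmul F F M (X : F[X])

theorem mulX_pow_apply {F M : Type*} [Field F] [AddCommGroup M] [Module F M] [Module F[X] M]
    [IsScalarTower F F[X] M] (n : ℕ) (m : M) : (mulX F M ^ n) m = (X ^ n : F[X]) • m := by
  rw [mulX, ← map_pow]
  rfl

/-- The cyclic module `F[X] / X ^ c`. -/
abbrev TruncPoly (F : Type*) [Field F] (c : ℕ) : Type _ := F[X] ⧸ Ideal.span {(X : F[X]) ^ c}

/-- A single nilpotent Jordan block of size `c`. -/
noncomputable abbrev shift (F : Type*) [Field F] (c : ℕ) : Module.End F (TruncPoly F c) :=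
  mulX F (TruncPoly F c)

variable {F V W : Type*} [Field F] [AddCommGroup V] [Module F V] [AddCommGroup W] [Module F W]

theorem finrank_truncPoly (c : ℕ) : Module.finrank F (TruncPoly F c) = c := by
  rw [finrank_quotient_span_eq_natDegree, natDegree_X_pow]

instance finite_truncPoly (c : ℕ) : FiniteDimensional F (TruncPoly F c) :=
  (Polynomial.monic_X_pow c).finite_quotient

theorem mk_X_pow_self (c : ℕ) : (Ideal.Quotient.mk (Ideal.span {(X : F[X]) ^ c})) (X ^ c) = 0 :=
  Ideal.Quotient.eq_zero_iff_mem.mpr (Ideal.mem_span_singleton_self _)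

theorem shift_pow_eq_zero {c n : ℕ} (h : c ≤ n) : shift F c ^ n = 0 := by
  refine LinearMap.ext fun m => ?_
  obtain ⟨p, rfl⟩ := Ideal.Quotient.mk_surjective m
  rw [mulX_pow_apply, ← Nat.sub_add_cancel h, pow_add, mul_smul]
  have : (X ^ c : F[X]) • Ideal.Quotient.mk (Ideal.span {(X : F[X]) ^ c}) p = 0 := by
    rw [← Ideal.Quotient.mk_eq_mk, ← Submodule.Quotient.mk_smul, Ideal.Quotient.mk_eq_mk,
      smul_eq_mul, map_mul, mk_X_pow_self, zero_mul]
  rw [this, smul_zero, LinearMap.zero_apply]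

theorem neg_eq_self_of_charTwo [CharP F 2] (v : V) : -v = v := by
  have : (-1 : F) = 1 := CharTwo.neg_eq 1
  rw [← neg_one_smul F v, this, one_smul]

/-- The map `w ⊗ p ↦ p(S) w`. -/
noncomputable def tensorTruncPolyHom (S : Module.End F W) (c : ℕ) :
    W ⊗[F] TruncPoly F c →ₗ[F] W ⧸ LinearMap.range (S ^ c) :=
  TensorProduct.lift (LinearMap.flip (Submodule.liftQ
    ((Ideal.span {(X : F[X]) ^ c}).restrictScalars F)
    (LinearMap.compRight F (LinearMap.range (S ^ c)).mkQ ∘ₗ (aeval S).toLinearMap) (by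
      intro p hp
      obtain ⟨r, rfl⟩ := Ideal.mem_span_singleton'.mp hp
      ext w
      simp [mul_comm r])))

theorem tensorTruncPolyHom_tmul (S : Module.End F W) (c : ℕ) (w : W) (p : F[X]) :
    tensorTruncPolyHom S c (w ⊗ₜ Ideal.Quotient.mk _ p) =
      Submodule.Quotient.mk (aeval S p w) := rfl

/-- In the cokernel X acts as -S, which is S in characteristic 2. Every class is therefore
represented by some w ⊗ 1, and the relation X^c = 0 becomes S^c w = 0. -/
theorem corank_tensorSum_shift [CharP F 2] (S : Module.End F W) (c : ℕ) :
    corank (tensorSum S (shift F c)) = corank (S ^ c) := by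
  set R := LinearMap.range (tensorSum S (shift F c))
  have hker : R ≤ LinearMap.ker (tensorTruncPolyHom S c) := by
    rintro _ ⟨x, rfl⟩
    rw [LinearMap.mem_ker]
    induction x with
    | zero => simp
    | add x y hx hy => simp [hx, hy]
    | tmul w p =>
      obtain ⟨p, rfl⟩ := Ideal.Quotient.mk_surjective p
      have : shift F c (Ideal.Quotient.mk _ p) = Ideal.Quotient.mk _ (p * X) := by
        rw [mul_comm]; rfl
      rw [tensorSum_tmul, this, map_add, tensorTruncPolyHom_tmul, tensorTruncPolyHom_tmul, map_mul,
        aeval_X, Module.End.mul_apply, ← sub_eq_zero.mpr rfl, sub_eq_add_neg,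
        neg_eq_self_of_charTwo (F := F)]
  have key (w : W) (p : F[X]) : (Submodule.Quotient.mk (aeval S p w ⊗ₜ Ideal.Quotient.mk _ 1) :
      (W ⊗[F] TruncPoly F c) ⧸ R) = Submodule.Quotient.mk (w ⊗ₜ Ideal.Quotient.mk _ p) := by
    have step (w : W) (p : F[X]) : (Submodule.Quotient.mk (S w ⊗ₜ Ideal.Quotient.mk _ p) :
        (W ⊗[F] TruncPoly F c) ⧸ R) = Submodule.Quotient.mk (w ⊗ₜ Ideal.Quotient.mk _ (X * p)) := by
      rw [Submodule.Quotient.eq, sub_eq_add_neg, neg_eq_self_of_charTwo (F := F)]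
      exact ⟨w ⊗ₜ Ideal.Quotient.mk _ p, tensorSum_tmul _ _ _ _⟩
    have hmon (n : ℕ) : ∀ (w : W), (Submodule.Quotient.mk ((S ^ n) w ⊗ₜ Ideal.Quotient.mk _ 1) :
      (W ⊗[F] TruncPoly F c) ⧸ R) = Submodule.Quotient.mk (w ⊗ₜ Ideal.Quotient.mk _ (X ^ n)) := by
      induction n with
      | zero => intro w; simp
      | succ n ih =>
        intro w
        rw [pow_succ, Module.End.mul_apply, ih, step, pow_succ']
    induction p using Polynomial.induction_on' with
    | add p q hp hq =>
      rw [map_add, map_add, LinearMap.add_apply, add_tmul, tmul_add, Submodule.Quotient.mk_add,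
        Submodule.Quotient.mk_add, hp, hq]
    | monomial n a =>
      rw [aeval_monomial, ← Algebra.smul_def, LinearMap.smul_apply, ← smul_X_eq_monomial,
        ← smul_tmul', Submodule.Quotient.mk_smul, hmon]
      rw [← Submodule.Quotient.mk_smul, ← tmul_smul]
      rfl
  refine LinearEquiv.finrank_eq (LinearEquiv.ofLinearMap (R.liftQ _ hker)
    (Submodule.liftQ _ (R.mkQ ∘ₗ (TensorProduct.mk F W (TruncPoly F c)).flip
      (Ideal.Quotient.mk _ 1)) ?_) ?_ ?_)
  · rintro _ ⟨w, rfl⟩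
    have := key w (X ^ c)
    rw [map_pow, aeval_X, mk_X_pow_self, tmul_zero] at this
    exact this
  · ext w
    have := tensorTruncPolyHom_tmul S c w 1
    rw [map_one (aeval S), Module.End.one_apply] at this
    exact this
  · refine Submodule.linearMap_qext _ (TensorProduct.ext' fun w p => ?_)
    obtain ⟨p, rfl⟩ := Ideal.Quotient.mk_surjective p
    exact key w p

end Shift

/-! ### Jordan types and jumps -/

section Jordan

variable {F V W : Type*} [Field F] [AddCommGroup V] [Module F V] [AddCommGroup W] [Module F W]

/-- `T` is conjugate to a direct sum of nilpotent Jordan blocks of sizes `k i`. -/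
def HasJordanType {ι : Type*} (T : Module.End F V) (k : ι → ℕ) : Prop :=
  ∃ e : V ≃ₗ[F] (∀ i, TruncPoly F (k i)), ∀ v i, e (T v) i = shift F (k i) (e v i)

theorem exists_hasJordanType [FiniteDimensional F V] {T : Module.End F V} (hT : IsNilpotent T) :
    ∃ (d : ℕ) (k : Fin d → ℕ), HasJordanType T k := by
  obtain ⟨n, hn⟩ := hT
  have htors : Module.IsTorsion' (Module.AEval' T) (Submonoid.powers (X : F[X])) := by
    intro x
    refine ⟨⟨X ^ n, n, rfl⟩, ?_⟩
    obtain ⟨v, rfl⟩ := (Module.AEval'.of T).surjective x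
    change (X ^ n : F[X]) • Module.AEval'.of T v = 0
    rw [Module.AEval'.X_pow_smul_of, hn]
    simp
  obtain ⟨d, k, ⟨e⟩⟩ := Module.torsion_by_prime_power_decomposition
    (Polynomial.irreducible_X (R := F)) htors
  refine ⟨d, k, ?_⟩
  let e₁ : Module.AEval' T ≃ₗ[F[X]] (∀ i, TruncPoly F (k i)) :=
    e ≪≫ₗ DirectSum.linearEquivFunOnFintype F[X] (Fin d) _
  refine ⟨Module.AEval'.of T ≪≫ₗ e₁.restrictScalars F, fun v i => ?_⟩
  change e₁ (Module.AEval'.of T (T v)) i = (X : F[X]) • e₁ (Module.AEval'.of T v) i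
  rw [← Module.AEval'.X_smul_of, map_smul]
  rfl

theorem corank_tensorSum_of_hasJordanType [FiniteDimensional F W] [CharP F 2] {ι : Type*}
    [Fintype ι] {T : Module.End F V}
    {k : ι → ℕ} (h : HasJordanType T k) (S : Module.End F W) :
    corank (tensorSum S T) = ∑ i, corank (S ^ k i) := by
  classical
  obtain ⟨e, he⟩ := h
  simp_rw [← corank_tensorSum_shift]
  rw [← corank_pi]
  refine corank_congr (TensorProduct.congr (LinearEquiv.refl F W) e ≪≫ₗ
    TensorProduct.piRight F F W (fun i => TruncPoly F (k i))) fun x => ?_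
  induction x with
  | zero => simp
  | add x y hx hy => simp only [map_add, hx, hy]
  | tmul w v =>
    ext i
    simp [he]

theorem corank_pow_of_hasJordanType [CharP F 2] {ι : Type*} [Fintype ι] {T : Module.End F V}
    {k : ι → ℕ} (h : HasJordanType T k) (b : ℕ) :
    corank (T ^ b) = ∑ i, min (k i) b := by
  rw [← corank_tensorSum_shift, corank_tensorSum_comm, corank_tensorSum_of_hasJordanType h]
  refine Finset.sum_congr rfl fun i _ => ?_
  rcases le_total b (k i) with hb | hb
  · rw [shift_pow_eq_zero hb, corank_zero, finrank_truncPoly, min_eq_right hb]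
  · rw [← corank_tensorSum_shift, corank_tensorSum_comm, corank_tensorSum_shift,
      shift_pow_eq_zero hb, corank_zero, finrank_truncPoly, min_eq_left hb]

theorem corank_shift_pow [CharP F 2] (c b : ℕ) : corank (shift F c ^ b) = min c b := by
  have : HasJordanType (shift F c) (fun _ : Unit => c) :=
    ⟨(LinearEquiv.funUnique Unit F (TruncPoly F c)).symm, fun v i => rfl⟩
  simpa using corank_pow_of_hasJordanType this b

/-- The number of Jordan blocks of size greater than `b` of a nilpotent endomorphism. -/
noncomputable def jump (T : Module.End F V) (b : ℕ) : ℤ :=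
  corank (T ^ (b + 1)) - corank (T ^ b)

theorem sum_range_jump (T : Module.End F V) (n : ℕ) :
    ∑ b ∈ Finset.range n, jump T b = corank (T ^ n) := by
  simp_rw [jump]
  rw [Finset.sum_range_sub (fun b => (corank (T ^ b) : ℤ)), pow_zero, corank_one]
  simp

theorem jump_eq_zero {T : Module.End F V} {n b : ℕ} (hT : T ^ n = 0) (h : n ≤ b) :
    jump T b = 0 := by
  rw [jump, pow_eq_zero_of_le h hT, pow_eq_zero_of_le (h.trans b.le_succ) hT, sub_self]

theorem jump_congr {T : Module.End F V} {S : Module.End F W} (e : V ≃ₗ[F] W)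
    (h : ∀ v, e (T v) = S (e v)) (b : ℕ) : jump T b = jump S b := by
  rw [jump, jump, corank_pow_congr e h, corank_pow_congr e h]

/-- The cokernel of `S ⊗ 1 + 1 ⊗ T` is determined by the Jordan types of `S` and `T`. -/
theorem corank_tensorSum_eq_sum_jump [FiniteDimensional F V] [FiniteDimensional F W] [CharP F 2]
    {T : Module.End F V} {n : ℕ} (hT : T ^ n = 0) (S : Module.End F W) :
    (corank (tensorSum S T) : ℤ) = ∑ b ∈ Finset.range n, jump T b * jump S b := by
  obtain ⟨d, k, hk⟩ := exists_hasJordanType ⟨n, hT⟩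
  have hkn : ∀ i, k i ≤ n := by
    -- N bounds every block size, and T^n and T^N are both zero. Comparing their coranks forces
    -- min(k i, n) = min(k i, N) = k i for each i.
    set N := n + ∑ i, k i
    have h : ∑ i, min (k i) n = ∑ i, min (k i) N := by
      rw [← corank_pow_of_hasJordanType hk, ← corank_pow_of_hasJordanType hk, hT,
        pow_eq_zero_of_le (Nat.le_add_right _ _) hT]
    have h2 := (Finset.sum_eq_sum_iff_of_le fun i _ =>
      min_le_min_left (k i) (Nat.le_add_right n (∑ i, k i))).mp h
    intro i
    have := h2 i (Finset.mem_univ i)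
    have := Finset.single_le_sum (f := k) (fun _ _ => Nat.zero_le _) (Finset.mem_univ i)
    omega
  have hjump (b : ℕ) : jump T b = ∑ i, if b < k i then 1 else 0 := by
    rw [jump, corank_pow_of_hasJordanType hk, corank_pow_of_hasJordanType hk]
    push_cast
    rw [← Finset.sum_sub_distrib]
    refine Finset.sum_congr rfl fun i _ => ?_
    split_ifs <;> omega
  rw [corank_tensorSum_of_hasJordanType hk]
  simp_rw [hjump, Finset.sum_mul]
  rw [Finset.sum_comm]
  push_cast
  refine Finset.sum_congr rfl fun i _ => ?_
  rw [← sum_range_jump]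
  simp_rw [ite_mul, one_mul, zero_mul]
  rw [← Finset.sum_filter]
  refine Finset.sum_congr ?_ fun _ _ => rfl
  ext b
  have := hkn i
  simp only [Finset.mem_range, Finset.mem_filter]
  omega

end Jordan

/-! ### Multiplicativity of the number of odd blocks -/

section OddBlocks

variable {F V W : Type*} [Field F] [AddCommGroup V] [Module F V] [AddCommGroup W] [Module F W]

/-- T ⊗ 1 and 1 ⊗ S commute, and squaring is additive on commuting operators in characteristic 2. -/
theorem tensorSum_pow_two_pow [CharP F 2] (T : Module.End F V) (S : Module.End F W) (n : ℕ) :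
    tensorSum T S ^ 2 ^ n = tensorSum (T ^ 2 ^ n) (S ^ 2 ^ n) := by
  induction n with
  | zero => simp
  | succ n ih =>
    rw [pow_succ, pow_mul, pow_mul, pow_mul, ih]
    refine TensorProduct.ext' fun v w => ?_
    rw [pow_two, pow_two, pow_two, Module.End.mul_apply, tensorSum_tmul, map_add, tensorSum_tmul,
      tensorSum_tmul, tensorSum_tmul, Module.End.mul_apply, Module.End.mul_apply]
    rw [add_assoc, ← add_assoc _ _ (v ⊗ₜ[F] _)]
    nth_rewrite 2 [← neg_eq_self_of_charTwo (F := F) ((T ^ 2 ^ n) v ⊗ₜ[F] (S ^ 2 ^ n) w)]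
    rw [add_neg_cancel, zero_add]

theorem tensorSum_pow_eq_zero [CharP F 2] {T : Module.End F V} {S : Module.End F W} {n : ℕ}
    (hT : T ^ 2 ^ n = 0) (hS : S ^ 2 ^ n = 0) : tensorSum T S ^ 2 ^ n = 0 := by
  rw [tensorSum_pow_two_pow, hT, hS]
  simp [tensorSum]

/-- The exponent c is traded for a third factor J_c, after which the three factors play symmetric
roles. -/
theorem corank_tensorSum_pow [CharP F 2] (T : Module.End F V) (S : Module.End F W) (c : ℕ) :
    corank (tensorSum T S ^ c) = corank (tensorSum T (tensorSum S (shift F c))) := by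
  rw [← corank_tensorSum_shift, corank_tensorSum_assoc]

theorem corank_tensorSum_pow' [CharP F 2] (T : Module.End F V) (S : Module.End F W) (c : ℕ) :
    corank (tensorSum T S ^ c) = corank (tensorSum (tensorSum T (shift F c)) S) := by
  rw [corank_tensorSum_pow, corank_tensorSum_assoc]
  exact corank_tensorSum_congr (LinearEquiv.refl F V) (TensorProduct.comm F W _) (fun _ => rfl)
    (tensorSum_comm _ _)

/-- The number of Jordan blocks of odd size of an endomorphism `T` with `T ^ n = 0`. -/
noncomputable def oddBlocks (n : ℕ) (T : Module.End F V) : ℤ :=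
  ∑ b ∈ Finset.range n, (-1) ^ b * jump T b

theorem oddBlocks_congr {T : Module.End F V} {S : Module.End F W} (e : V ≃ₗ[F] W)
    (h : ∀ v, e (T v) = S (e v)) (n : ℕ) : oddBlocks n T = oddBlocks n S := by
  simp_rw [oddBlocks, jump_congr e h]

theorem oddBlocks_tensorSum_comm (n : ℕ) (T : Module.End F V) (S : Module.End F W) :
    oddBlocks n (tensorSum T S) = oddBlocks n (tensorSum S T) :=
  oddBlocks_congr (TensorProduct.comm F V W) (tensorSum_comm T S) n

theorem oddBlocks_eq_of_le {T : Module.End F V} {m n : ℕ} (hT : T ^ m = 0) (h : m ≤ n) :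
    oddBlocks n T = oddBlocks m T := by
  symm
  refine Finset.sum_subset (Finset.range_mono h) fun b _ hb => ?_
  rw [jump_eq_zero hT (by simpa using hb), mul_zero]

theorem oddBlocks_two_mul (m : ℕ) (T : Module.End F V) :
    oddBlocks (2 * m) T = ∑ k ∈ Finset.range m, (jump T (2 * k) - jump T (2 * k + 1)) := by
  induction m with
  | zero => simp [oddBlocks]
  | succ m ih =>
    rw [oddBlocks, show 2 * (m + 1) = 2 * m + 1 + 1 by ring, Finset.sum_range_succ,
      Finset.sum_range_succ, Finset.sum_range_succ, ← oddBlocks, ih, pow_succ, pow_mul]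
    ring

/-- By trading, (S + J_2a)^c and (S + J_c)^(2a) have equal corank. The square of S + J_c is S^2 +
J_c^2, and the remaining exponent a turns into the factor J_a. The coefficient of each jump is the
jump of J_c^2 at b. -/
theorem corank_shift_even_tensorSum_pow [CharP F 2] [FiniteDimensional F W] (S : Module.End F W)
    (a : ℕ) {c n : ℕ} (hc : c ≤ 2 * n) :
    (corank (tensorSum S (shift F (2 * a)) ^ c) : ℤ) = ∑ b ∈ Finset.range n,
      ((min c (2 * (b + 1)) : ℕ) - (min c (2 * b) : ℕ)) * jump (tensorSum (S ^ 2) (shift F a)) b := by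
  have h2 : tensorSum S (shift F c) ^ 2 = tensorSum (S ^ 2) (shift F c ^ 2) := by
    simpa using tensorSum_pow_two_pow S (shift F c) 1
  have hz : (shift F c ^ 2) ^ n = 0 := by
    rw [← pow_mul, shift_pow_eq_zero hc]
  rw [corank_tensorSum_pow', corank_tensorSum_shift, pow_mul, h2, corank_tensorSum_pow',
    corank_tensorSum_eq_sum_jump hz]
  refine Finset.sum_congr rfl fun b _ => ?_
  rw [jump, ← pow_mul, ← pow_mul, corank_shift_pow, corank_shift_pow]

/-- Raising c by one changes the coefficients of the preceding formula only at b = c / 2, and there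
by 1. Jumps at 2k and 2k + 1 thus agree: all blocks have even size. -/
theorem jump_tensorSum_shift_even [CharP F 2] [FiniteDimensional F W] (S : Module.End F W)
    (a c : ℕ) : jump (tensorSum S (shift F (2 * a))) c =
      jump (tensorSum (S ^ 2) (shift F a)) (c / 2) := by
  rw [jump, corank_shift_even_tensorSum_pow S a (n := c + 1) (by omega),
    corank_shift_even_tensorSum_pow S a (n := c + 1) (by omega), ← Finset.sum_sub_distrib,
    Finset.sum_eq_single (c / 2)]
  · have h1 : min (c + 1) (2 * (c / 2 + 1)) = c + 1 := by omega
    have h2 : min (c + 1) (2 * (c / 2)) = 2 * (c / 2) := by omega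
    have h3 : min c (2 * (c / 2 + 1)) = c := by omega
    have h4 : min c (2 * (c / 2)) = 2 * (c / 2) := by omega
    rw [h1, h2, h3, h4]
    push_cast
    ring
  · intro b _ hb
    rcases lt_or_gt_of_ne hb with h | h
    · have h1 : min (c + 1) (2 * (b + 1)) = 2 * (b + 1) := by omega
      have h2 : min (c + 1) (2 * b) = 2 * b := by omega
      have h3 : min c (2 * (b + 1)) = 2 * (b + 1) := by omega
      have h4 : min c (2 * b) = 2 * b := by omega
      rw [h1, h2, h3, h4, sub_self]
    · have h1 : min (c + 1) (2 * (b + 1)) = c + 1 := by omega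
      have h2 : min (c + 1) (2 * b) = c + 1 := by omega
      have h3 : min c (2 * (b + 1)) = c := by omega
      have h4 : min c (2 * b) = c := by omega
      rw [h1, h2, h3, h4]
      ring
  · intro h
    exact absurd (Finset.mem_range.mpr (by omega)) h

theorem oddBlocks_tensorSum_shift_even [CharP F 2] [FiniteDimensional F W] (S : Module.End F W)
    (a m : ℕ) : oddBlocks (2 * m) (tensorSum S (shift F (2 * a))) = 0 := by
  rw [oddBlocks_two_mul]
  refine Finset.sum_eq_zero fun k _ => ?_
  rw [jump_tensorSum_shift_even, jump_tensorSum_shift_even,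
    show (2 * k + 1) / 2 = 2 * k / 2 by omega, sub_self]

/-! ### Reflection of a block of size a to size 2^n - a -/

theorem corank_add_finrank_range [FiniteDimensional F V] (T : Module.End F V) :
    corank T + Module.finrank F (LinearMap.range T) = Module.finrank F V :=
  Submodule.finrank_quotient_add_finrank _

theorem corank_eq_finrank_ker [FiniteDimensional F V] (T : Module.End F V) :
    corank T = Module.finrank F (LinearMap.ker T) := by
  have := LinearMap.finrank_range_add_finrank_ker T
  have := corank_add_finrank_range T
  omega

/-- Restrict p to the range of T', which is the kernel of T. The restriction has image the range of
B and kernel isomorphic to that of A, and rank-nullity gives the count. -/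
theorem corank_add_finrank_of_exact {K P M : Type*} [AddCommGroup K] [Module F K] [AddCommGroup P]
    [Module F P] [AddCommGroup M] [Module F M] [FiniteDimensional F K] [FiniteDimensional F P]
    [FiniteDimensional F M] {i : K →ₗ[F] P} {p : P →ₗ[F] M} (hi : Function.Injective i)
    (hp : Function.Surjective p) (hip : Function.Exact i p) {A : Module.End F K}
    {T T' : Module.End F P} {B : Module.End F M} (hA : ∀ x, i (A x) = T (i x))
    (hB : ∀ x, p (T' x) = B (p x)) (hT : LinearMap.ker T = LinearMap.range T') :
    corank A + Module.finrank F M = corank B + Module.finrank F (LinearMap.range T') := by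
  have hrange : LinearMap.range (p.domRestrict (LinearMap.range T')) = LinearMap.range B := by
    ext m
    simp only [LinearMap.mem_range]
    constructor
    · rintro ⟨⟨_, x, rfl⟩, rfl⟩
      exact ⟨p x, (hB x).symm⟩
    · rintro ⟨y, rfl⟩
      obtain ⟨x, rfl⟩ := hp y
      exact ⟨⟨_, x, rfl⟩, hB x⟩
  have hker : Module.finrank F (LinearMap.ker (p.domRestrict (LinearMap.range T'))) =
      Module.finrank F (LinearMap.ker A) := by
    rw [(Submodule.equivMapOfInjective (LinearMap.range T').subtype
      (Submodule.injective_subtype _) (LinearMap.ker (p.domRestrict _))).finrank_eq,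
      (Submodule.equivMapOfInjective i hi (LinearMap.ker A)).finrank_eq]
    suffices h : Submodule.map (LinearMap.range T').subtype (LinearMap.ker (p.domRestrict _)) =
        Submodule.map i (LinearMap.ker A) by rw [h]
    ext x
    simp only [Submodule.mem_map, LinearMap.mem_ker]
    constructor
    · rintro ⟨⟨x, hx⟩, h, rfl⟩
      obtain ⟨y, rfl⟩ := (hip x).mp h
      refine ⟨y, hi ?_, rfl⟩
      rw [hA, map_zero, ← LinearMap.mem_ker, hT]
      exact hx
    · rintro ⟨y, hy, rfl⟩
      refine ⟨⟨i y, ?_⟩, (hip _).mpr ⟨y, rfl⟩, rfl⟩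
      rw [← hT, LinearMap.mem_ker, ← hA, hy, map_zero]
  have h1 := LinearMap.finrank_range_add_finrank_ker (p.domRestrict (LinearMap.range T'))
  have h2 := corank_add_finrank_range B
  rw [hrange, hker, ← corank_eq_finrank_ker] at h1
  omega

/-- Multiplication by `X ^ a`, as a map `F[X] / X ^ c → F[X] / X ^ (c + a)`. -/
noncomputable def truncPolyInclusion (F : Type*) [Field F] (c a : ℕ) :
    TruncPoly F c →ₗ[F[X]] TruncPoly F (c + a) :=
  Submodule.mapQ _ _ (LinearMap.mulLeft F[X] (X ^ a)) (by
    intro p hp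
    obtain ⟨r, rfl⟩ := Ideal.mem_span_singleton'.mp hp
    refine Ideal.mem_span_singleton'.mpr ⟨r, ?_⟩
    simp only [LinearMap.mulLeft_apply]
    ring)

/-- The projection `F[X] / X ^ (c + a) → F[X] / X ^ a`. -/
noncomputable def truncPolyProjection (F : Type*) [Field F] (c a : ℕ) :
    TruncPoly F (c + a) →ₗ[F[X]] TruncPoly F a :=
  Submodule.mapQ _ _ LinearMap.id (by
    intro p hp
    obtain ⟨r, rfl⟩ := Ideal.mem_span_singleton'.mp hp
    refine Ideal.mem_span_singleton'.mpr ⟨r * X ^ c, ?_⟩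
    exact (mul_assoc _ _ _).trans (congrArg _ (pow_add X c a).symm))

theorem truncPolyInclusion_mk (c a : ℕ) (f : F[X]) :
    truncPolyInclusion F c a (Ideal.Quotient.mk _ f) = Ideal.Quotient.mk _ (X ^ a * f) := rfl

theorem truncPolyProjection_mk (c a : ℕ) (f : F[X]) :
    truncPolyProjection F c a (Ideal.Quotient.mk _ f) = Ideal.Quotient.mk _ f := rfl

theorem truncPolyInclusion_injective (c a : ℕ) :
    Function.Injective (truncPolyInclusion F c a) := by
  rw [injective_iff_map_eq_zero]
  intro x hx
  obtain ⟨f, rfl⟩ := Ideal.Quotient.mk_surjective x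
  rw [truncPolyInclusion_mk, Ideal.Quotient.eq_zero_iff_mem, Ideal.mem_span_singleton, add_comm,
    pow_add] at hx
  rw [Ideal.Quotient.eq_zero_iff_mem, Ideal.mem_span_singleton]
  exact (mul_dvd_mul_iff_left (pow_ne_zero a X_ne_zero)).mp hx

theorem truncPolyProjection_surjective (c a : ℕ) :
    Function.Surjective (truncPolyProjection F c a) := by
  intro x
  obtain ⟨f, rfl⟩ := Ideal.Quotient.mk_surjective x
  exact ⟨Ideal.Quotient.mk _ f, rfl⟩

theorem truncPoly_exact (c a : ℕ) :
    Function.Exact (truncPolyInclusion F c a) (truncPolyProjection F c a) := by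
  intro x
  obtain ⟨f, rfl⟩ := Ideal.Quotient.mk_surjective x
  rw [truncPolyProjection_mk, Ideal.Quotient.eq_zero_iff_mem, Ideal.mem_span_singleton]
  constructor
  · rintro ⟨g, rfl⟩
    exact ⟨Ideal.Quotient.mk _ g, rfl⟩
  · rintro ⟨y, hy⟩
    obtain ⟨g, rfl⟩ := Ideal.Quotient.mk_surjective y
    rw [truncPolyInclusion_mk, Ideal.Quotient.eq, Ideal.mem_span_singleton] at hy
    have h : (X : F[X]) ^ a ∣ X ^ a * g - f := (pow_dvd_pow X (Nat.le_add_left a c)).trans hy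
    exact (dvd_sub_right (dvd_mul_right _ _)).mp h

theorem lTensor_tensorSum {K M : Type*} [AddCommGroup K] [Module F K] [AddCommGroup M] [Module F M]
    (S : Module.End F W) {A : Module.End F K} {B : Module.End F M} (i : K →ₗ[F] M)
    (h : ∀ x, i (A x) = B (i x)) (x : W ⊗[F] K) :
    LinearMap.lTensor W i (tensorSum S A x) = tensorSum S B (LinearMap.lTensor W i x) := by
  induction x with
  | zero => simp
  | add x y hx hy => simp only [map_add, hx, hy]
  | tmul x y => simp [h]

/-- By trading, this is the corank of (S + J_c)^(2^n), which is zero. In effect every Jordan block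
of S + J_(2^n) has the full size 2^n. -/
theorem corank_tensorSum_shift_pow_of_le [CharP F 2] [FiniteDimensional F W] {S : Module.End F W}
    {n c : ℕ} (hS : S ^ 2 ^ n = 0) (hc : c ≤ 2 ^ n) :
    corank (tensorSum S (shift F (2 ^ n)) ^ c) = Module.finrank F W * c := by
  rw [corank_tensorSum_pow', corank_tensorSum_shift,
    tensorSum_pow_eq_zero hS (shift_pow_eq_zero hc), corank_zero, Module.finrank_tensorProduct,
    finrank_truncPoly]

/-- Tensor the exact sequence J_a' → J_q → J_a with W, where q = 2^n. All blocks in the middle have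
size q, so there the kernel of the c'-th power is the range of the c-th. Up to blocks of size q, the
outer terms exchange block sizes k and q - k. -/
theorem corank_tensorSum_shift_reflect [CharP F 2] [FiniteDimensional F W] {S : Module.End F W}
    {n a a' c c' : ℕ} (hS : S ^ 2 ^ n = 0) (ha : a' + a = 2 ^ n) (hc : c' + c = 2 ^ n) :
    corank (tensorSum S (shift F a') ^ c') + Module.finrank F W * a =
      corank (tensorSum S (shift F a) ^ c) + Module.finrank F W * c' := by
  have hfree (c : ℕ) (hc : c ≤ 2 ^ n) :
      corank (tensorSum S (shift F (a' + a)) ^ c) = Module.finrank F W * c := by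
    rw [ha]
    exact corank_tensorSum_shift_pow_of_le hS hc
  have hrank : Module.finrank F (LinearMap.range (tensorSum S (shift F (a' + a)) ^ c)) =
      Module.finrank F W * c' := by
    have := corank_add_finrank_range (tensorSum S (shift F (a' + a)) ^ c)
    have hsum : Module.finrank F W * (a' + a) =
        Module.finrank F W * c + Module.finrank F W * c' := by
      rw [← mul_add, show a' + a = c + c' by omega]
    rw [hfree c (by omega), Module.finrank_tensorProduct, finrank_truncPoly, hsum] at this
    exact Nat.add_left_cancel this
  have hker : LinearMap.ker (tensorSum S (shift F (a' + a)) ^ c') =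
      LinearMap.range (tensorSum S (shift F (a' + a)) ^ c) := by
    symm
    apply Submodule.eq_of_le_of_finrank_eq
    · rintro _ ⟨x, rfl⟩
      rw [LinearMap.mem_ker, ← Module.End.mul_apply, ← pow_add, hc,
        tensorSum_pow_eq_zero hS (shift_pow_eq_zero ha.le), LinearMap.zero_apply]
    · rw [hrank, ← corank_eq_finrank_ker, hfree c' (by omega)]
  have := corank_add_finrank_of_exact
    (i := LinearMap.lTensor W ((truncPolyInclusion F a' a).restrictScalars F))
    (p := LinearMap.lTensor W ((truncPolyProjection F a' a).restrictScalars F))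
    (A := tensorSum S (shift F a') ^ c') (B := tensorSum S (shift F a) ^ c)
    (Module.Flat.lTensor_preserves_injective_linearMap _ (truncPolyInclusion_injective a' a))
    (LinearMap.lTensor_surjective W (truncPolyProjection_surjective a' a))
    (lTensor_exact W (truncPoly_exact a' a) (truncPolyProjection_surjective a' a))
    (pow_intertwine (lTensor_tensorSum S _ fun x =>
      map_smul (truncPolyInclusion F a' a) (X : F[X]) x) c')
    (pow_intertwine (lTensor_tensorSum S _ fun x =>
      map_smul (truncPolyProjection F a' a) (X : F[X]) x) c) hker
  rwa [hrank, Module.finrank_tensorProduct, finrank_truncPoly] at this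

/-- Each difference jump(2k) - jump(2k + 1) is, up to sign, a second difference of coranks of
powers, so the terms affine in the exponent drop out of the reflection identity. Since 2^(n+1) is
even, reflecting exponents permutes the triples (2k, 2k + 1, 2k + 2). -/
theorem oddBlocks_tensorSum_shift_reflect [CharP F 2] [FiniteDimensional F W]
    {S : Module.End F W} {n a a' : ℕ} (hS : S ^ 2 ^ (n + 1) = 0) (ha : a' + a = 2 ^ (n + 1)) :
    oddBlocks (2 ^ (n + 1)) (tensorSum S (shift F a')) =
      oddBlocks (2 ^ (n + 1)) (tensorSum S (shift F a)) := by
  rw [pow_succ', oddBlocks_two_mul, oddBlocks_two_mul, ← Finset.sum_range_reflect]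
  refine Finset.sum_congr rfl fun k hk => ?_
  have hk := Finset.mem_range.mp hk
  obtain ⟨l, hl⟩ : ∃ l, l + k + 1 = 2 ^ n := ⟨2 ^ n - k - 1, by omega⟩
  rw [show 2 ^ n - 1 - k = l by omega, jump, jump, jump, jump]
  have hq : 2 ^ (n + 1) = 2 * (l + k + 1) := by rw [hl, pow_succ']
  have h0 := corank_tensorSum_shift_reflect hS ha (c' := 2 * l) (c := 2 * k + 1 + 1) (by omega)
  have h1 := corank_tensorSum_shift_reflect hS ha (c' := 2 * l + 1) (c := 2 * k + 1) (by omega)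
  have h2 := corank_tensorSum_shift_reflect hS ha (c' := 2 * l + 1 + 1) (c := 2 * k) (by omega)
  zify at h0 h1 h2
  linear_combination 2 * h1 - h0 - h2

/-- A size above 2^n is reflected to 2^(n+1) minus itself, which has the same parity and is at most
2^n. Once both sizes are small the inductive hypothesis applies. -/
theorem oddBlocks_tensorSum_shift_shift [CharP F 2] (n : ℕ) : ∀ {a b : ℕ}, a ≤ 2 ^ n → b ≤ 2 ^ n →
    oddBlocks (2 ^ n) (tensorSum (shift F a) (shift F b)) = ((a % 2) * (b % 2) : ℕ) := by
  induction n with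
  | zero =>
    intro a b ha hb
    simp only [oddBlocks, pow_zero, Finset.range_one, Finset.sum_singleton, one_mul, jump, zero_add,
      pow_one, corank_one]
    rw [corank_tensorSum_shift, corank_shift_pow]
    have ha : a ≤ 1 := by simpa using ha
    have hb : b ≤ 1 := by simpa using hb
    interval_cases a <;> interval_cases b <;> simp
  | succ n ih =>
    have heven {a b : ℕ} (hb : b % 2 = 0) :
        oddBlocks (2 ^ (n + 1)) (tensorSum (shift F a) (shift F b)) = 0 := by
      obtain ⟨b, rfl⟩ := Nat.dvd_of_mod_eq_zero hb
      rw [pow_succ', oddBlocks_tensorSum_shift_even]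
    have hsmall {a b : ℕ} (ha : a ≤ 2 ^ n) (hb : b ≤ 2 ^ n) :
        oddBlocks (2 ^ (n + 1)) (tensorSum (shift F a) (shift F b)) =
          ((a % 2) * (b % 2) : ℕ) := by
      rw [oddBlocks_eq_of_le (tensorSum_pow_eq_zero (shift_pow_eq_zero ha) (shift_pow_eq_zero hb))
        (Nat.pow_le_pow_right two_pos n.le_succ), ih ha hb]
    have hq : 2 ^ (n + 1) = 2 * 2 ^ n := pow_succ' 2 n
    have hleft {a b : ℕ} (ha : a ≤ 2 ^ n) (hb : b ≤ 2 ^ (n + 1)) :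
        oddBlocks (2 ^ (n + 1)) (tensorSum (shift F a) (shift F b)) =
          ((a % 2) * (b % 2) : ℕ) := by
      rcases le_total b (2 ^ n) with h | h
      · exact hsmall ha h
      · rw [oddBlocks_tensorSum_shift_reflect (a := 2 ^ (n + 1) - b)
          (shift_pow_eq_zero (by omega)) (by omega), hsmall ha (by omega),
          show (2 ^ (n + 1) - b) % 2 = b % 2 by omega]
    intro a b ha hb
    rcases le_total a (2 ^ n) with h | h
    · exact hleft h hb
    · rw [oddBlocks_tensorSum_comm, oddBlocks_tensorSum_shift_reflect (a := 2 ^ (n + 1) - a)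
        (shift_pow_eq_zero hb) (by omega), oddBlocks_tensorSum_comm, hleft (by omega) hb,
        show (2 ^ (n + 1) - a) % 2 = a % 2 by omega]

/-- The jumps of T + S are a sum over pairs of blocks. Since `jump T i` counts blocks larger than i,
summation by parts in both sizes produces the mixed second difference. It arises by applying
`corank_tensorSum_eq_sum_jump` twice, with the exponent c carried as a factor J_c. -/
theorem jump_tensorSum_eq [CharP F 2] [FiniteDimensional F V] [FiniteDimensional F W]
    {T : Module.End F V} {S : Module.End F W} {m n : ℕ} (hT : T ^ m = 0) (hS : S ^ n = 0) (c : ℕ) :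
    jump (tensorSum T S) c = ∑ i ∈ Finset.range m, ∑ j ∈ Finset.range n, jump T i * jump S j *
      (jump (tensorSum (shift F (i + 1)) (shift F (j + 1))) c
        - jump (tensorSum (shift F (i + 1)) (shift F j)) c
        - jump (tensorSum (shift F i) (shift F (j + 1))) c
        + jump (tensorSum (shift F i) (shift F j)) c) := by
  -- Both sides are the corank of J_c + J_i + J_j.
  have hD (c i j : ℕ) : corank (tensorSum (shift F c) (shift F i) ^ j) =
      corank (tensorSum (shift F i) (shift F j) ^ c) := by
    rw [corank_tensorSum_pow, corank_tensorSum_comm, corank_tensorSum_shift]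
  have h (c : ℕ) : (corank (tensorSum T S ^ c) : ℤ) =
      ∑ i ∈ Finset.range m, ∑ j ∈ Finset.range n, jump T i * jump S j *
      (corank (tensorSum (shift F (i + 1)) (shift F (j + 1)) ^ c)
        - corank (tensorSum (shift F (i + 1)) (shift F j) ^ c)
        - corank (tensorSum (shift F i) (shift F (j + 1)) ^ c)
        + corank (tensorSum (shift F i) (shift F j) ^ c)) := by
    have h2 (i : ℕ) : (corank (tensorSum S (shift F c) ^ i) : ℤ) = ∑ j ∈ Finset.range n,
        jump S j * jump (tensorSum (shift F c) (shift F i)) j := by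
      rw [corank_tensorSum_pow, corank_tensorSum_comm, corank_tensorSum_eq_sum_jump hS]
    rw [corank_tensorSum_pow, corank_tensorSum_comm, corank_tensorSum_eq_sum_jump hT]
    refine Finset.sum_congr rfl fun i _ => ?_
    rw [jump.eq_def (tensorSum S (shift F c)), h2, h2, ← Finset.sum_sub_distrib, Finset.mul_sum]
    refine Finset.sum_congr rfl fun j _ => ?_
    rw [jump.eq_def (tensorSum _ _), jump.eq_def (tensorSum _ _), hD c (i + 1) (j + 1), hD c (i + 1) j,
      hD c i (j + 1), hD c i j]
    ring
  rw [jump, h, h, ← Finset.sum_sub_distrib]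
  refine Finset.sum_congr rfl fun i _ => ?_
  rw [← Finset.sum_sub_distrib]
  refine Finset.sum_congr rfl fun j _ => ?_
  simp only [jump]
  ring

theorem oddBlocks_tensorSum [CharP F 2] [FiniteDimensional F V] [FiniteDimensional F W]
    {T : Module.End F V} {S : Module.End F W} {n : ℕ} (hT : T ^ 2 ^ n = 0) (hS : S ^ 2 ^ n = 0) :
    oddBlocks (2 ^ n) (tensorSum T S) = oddBlocks (2 ^ n) T * oddBlocks (2 ^ n) S := by
  rw [oddBlocks]
  simp_rw [jump_tensorSum_eq hT hS, Finset.mul_sum]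
  rw [Finset.sum_comm, oddBlocks, oddBlocks, Finset.sum_mul_sum]
  refine Finset.sum_congr rfl fun i hi => ?_
  rw [Finset.sum_comm]
  refine Finset.sum_congr rfl fun j hj => ?_
  have hi := Finset.mem_range.mp hi
  have hj := Finset.mem_range.mp hj
  -- The mixed second difference of (i % 2)(j % 2) factors into two first differences, each of them
  -- an alternating sign.
  have hpar (k : ℕ) : (((k + 1) % 2 : ℕ) : ℤ) - (k % 2 : ℕ) = (-1) ^ k := by
    rcases Nat.even_or_odd k with h | h
    · rw [h.neg_one_pow, Nat.even_iff.mp h, Nat.odd_iff.mp h.add_one]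
      norm_num
    · rw [h.neg_one_pow, Nat.odd_iff.mp h, Nat.even_iff.mp h.add_one]
      norm_num
  have e1 := oddBlocks_tensorSum_shift_shift (F := F) n (a := i + 1) (b := j + 1) hi hj
  have e2 := oddBlocks_tensorSum_shift_shift (F := F) n (a := i + 1) (b := j) hi hj.le
  have e3 := oddBlocks_tensorSum_shift_shift (F := F) n (a := i) (b := j + 1) hi.le hj
  have e4 := oddBlocks_tensorSum_shift_shift (F := F) n (a := i) (b := j) hi.le hj.le
  rw [← hpar i, ← hpar j]
  trans jump T i * jump S j *
      (oddBlocks (2 ^ n) (tensorSum (shift F (i + 1)) (shift F (j + 1)))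
        - oddBlocks (2 ^ n) (tensorSum (shift F (i + 1)) (shift F j))
        - oddBlocks (2 ^ n) (tensorSum (shift F i) (shift F (j + 1)))
        + oddBlocks (2 ^ n) (tensorSum (shift F i) (shift F j)))
  · simp_rw [oddBlocks]
    rw [← Finset.sum_sub_distrib, ← Finset.sum_sub_distrib, ← Finset.sum_add_distrib,
      Finset.mul_sum]
    refine Finset.sum_congr rfl fun c _ => ?_
    ring
  · rw [e1, e2, e3, e4]
    push_cast
    ring

end OddBlocks

/-! ### Truncated power series rings and Hilbert-Kunz numbers as coranks -/

section TruncSeries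

variable {σ F : Type*} [Field F]

/-- The ideal `(x_s ^ q : s ∈ σ)`. -/
noncomputable def varPowIdeal (σ F : Type*) [Field F] (q : ℕ) : Ideal (MvPowerSeries σ F) :=
  Ideal.span (Set.range fun s : σ => (MvPowerSeries.X s : MvPowerSeries σ F) ^ q)

theorem mem_varPowIdeal_iff [Finite σ] {q : ℕ} {f : MvPowerSeries σ F} :
    f ∈ varPowIdeal σ F q ↔ ∀ m : σ →₀ ℕ, (∀ s, m s < q) → MvPowerSeries.coeff m f = 0 := by
  classical
  constructor
  · intro hf
    refine Submodule.span_induction ?_ ?_ ?_ ?_ hf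
    · rintro _ ⟨s, rfl⟩ m hm
      rw [MvPowerSeries.coeff_X_pow, if_neg]
      rintro rfl
      simpa using hm s
    · simp
    · intro x y _ _ hx hy m hm
      rw [map_add, hx m hm, hy m hm, add_zero]
    · intro r x _ hx m hm
      rw [smul_eq_mul, MvPowerSeries.coeff_mul]
      refine Finset.sum_eq_zero fun p hp => ?_
      rw [hx p.2 fun s => lt_of_le_of_lt ?_ (hm s), mul_zero]
      rw [← Finset.HasAntidiagonal.mem_antidiagonal.mp hp]
      simp
  · intro hf
    have := Fintype.ofFinite σ
    -- Each monomial outside the box is assigned one variable of exponent at least q. This splits f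
    -- into pieces `g s` divisible by X_s^q.
    let c : (σ →₀ ℕ) → Option σ := fun m => if h : ∃ s, q ≤ m s then some h.choose else none
    let g : σ → MvPowerSeries σ F := fun s m => if c m = some s then MvPowerSeries.coeff m f else 0
    have hg (s : σ) (m : σ →₀ ℕ) : MvPowerSeries.coeff m (g s) =
      if c m = some s then MvPowerSeries.coeff m f else 0 := rfl
    have hfg : f = ∑ s, g s := by
      ext m
      rw [map_sum]
      simp_rw [hg]
      by_cases h : ∃ s, q ≤ m s
      · have hc : c m = some h.choose := dif_pos h
        simp [hc]
      · have hc : c m = none := dif_neg h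
        push Not at h
        simp [hc, hf m h]
    rw [hfg]
    refine Ideal.sum_mem _ fun s _ => ?_
    obtain ⟨r, hr⟩ : (MvPowerSeries.X s : MvPowerSeries σ F) ^ q ∣ g s := by
      rw [MvPowerSeries.X_pow_dvd_iff]
      intro m hm
      rw [hg, if_neg]
      intro hc
      by_cases h : ∃ s, q ≤ m s
      · have hc' : c m = some h.choose := dif_pos h
        rw [hc'] at hc
        have := h.choose_spec
        rw [Option.some_injective _ hc] at this
        omega
      · have hc' : c m = none := dif_neg h
        simp [hc'] at hc
    rw [hr]
    exact Ideal.mul_mem_right _ _ (Ideal.subset_span ⟨s, rfl⟩)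

/-- The truncated power series ring `F[[x_s : s ∈ σ]] / (x_s ^ q : s ∈ σ)`. -/
abbrev TruncSeries (σ F : Type*) [Field F] (q : ℕ) : Type _ := MvPowerSeries σ F ⧸ varPowIdeal σ F q

/-- The coefficients of a power series at the monomials with all exponents less than `q`. -/
noncomputable def boxCoeff (σ F : Type*) [Finite σ] [Field F] (q : ℕ) :
    MvPowerSeries σ F →ₗ[F] ((σ → Fin q) → F) :=
  LinearMap.pi fun k => MvPowerSeries.coeff (Finsupp.equivFunOnFinite.symm fun s => (k s : ℕ))

theorem ker_boxCoeff [Finite σ] (q : ℕ) :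
    LinearMap.ker (boxCoeff σ F q) = (varPowIdeal σ F q).restrictScalars F := by
  ext f
  rw [LinearMap.mem_ker, Submodule.restrictScalars_mem, mem_varPowIdeal_iff, funext_iff]
  constructor
  · intro h m hm
    have := h fun s => ⟨m s, hm s⟩
    simpa [boxCoeff] using this
  · intro h k
    exact h _ fun s => by simp

theorem boxCoeff_surjective [Finite σ] (q : ℕ) : Function.Surjective (boxCoeff σ F q) := by
  classical
  intro v
  let f : MvPowerSeries σ F := fun m => if h : ∀ s, m s < q then v fun s => ⟨m s, h s⟩ else 0
  refine ⟨f, funext fun k => ?_⟩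
  have : ∀ s, (Finsupp.equivFunOnFinite.symm fun s => (k s : ℕ)) s < q := fun s => by simp
  exact (dif_pos this).trans (by simp)

/-- A truncated power series is determined by its coefficients in the box. -/
noncomputable def truncSeriesEquiv (σ F : Type*) [Finite σ] [Field F] (q : ℕ) :
    TruncSeries σ F q ≃ₗ[F] ((σ → Fin q) → F) :=
  (Submodule.Quotient.restrictScalarsEquiv F (varPowIdeal σ F q)).symm ≪≫ₗ
    Submodule.quotEquivOfEq _ _ (ker_boxCoeff q).symm ≪≫ₗ
    LinearMap.quotKerEquivOfSurjective _ (boxCoeff_surjective q)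

instance finite_truncSeries [Finite σ] (q : ℕ) : FiniteDimensional F (TruncSeries σ F q) :=
  Module.Finite.equiv (truncSeriesEquiv σ F q).symm

theorem finrank_truncSeries [Fintype σ] (q : ℕ) :
    Module.finrank F (TruncSeries σ F q) = q ^ Fintype.card σ := by
  classical
  rw [(truncSeriesEquiv σ F q).finrank_eq, Module.finrank_fintype_fun_eq_card, Fintype.card_fun,
    Fintype.card_fin]

/-- The image of a power series in the truncated power series ring. -/
noncomputable def truncMk (q : ℕ) : MvPowerSeries σ F →ₐ[F] TruncSeries σ F q :=
  Ideal.Quotient.mkₐ F _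

theorem truncMk_surjective (q : ℕ) : Function.Surjective (truncMk (σ := σ) (F := F) q) :=
  Ideal.Quotient.mk_surjective

theorem truncMk_eq_zero {q : ℕ} {f : MvPowerSeries σ F} :
    truncMk q f = 0 ↔ f ∈ varPowIdeal σ F q :=
  Ideal.Quotient.eq_zero_iff_mem

theorem monomial_eq_prod_X_pow [Fintype σ] (m : σ →₀ ℕ) :
    (MvPowerSeries.monomial m 1 : MvPowerSeries σ F) = ∏ s, MvPowerSeries.X s ^ m s := by
  have := congrArg (fun p : MvPolynomial σ F => (p : MvPowerSeries σ F))
    (MvPolynomial.monomial_eq (s := m) (a := (1 : F)))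
  simp only [MvPolynomial.coe_monomial, map_one, one_mul] at this
  rw [this, Finsupp.prod_fintype _ _ (by simp)]
  have h := map_prod (MvPolynomial.coeToMvPowerSeries.ringHom (σ := σ) (R := F))
    (fun s => MvPolynomial.X s ^ m s) Finset.univ
  exact h.trans (by simp)

theorem eq_top_of_prod_X_pow_mem [Fintype σ] {q : ℕ} {p : Submodule F (TruncSeries σ F q)}
    (h : ∀ m : σ → ℕ, truncMk q (∏ s, MvPowerSeries.X s ^ m s) ∈ p) : p = ⊤ := by
  classical
  rw [eq_top_iff]
  intro x _
  obtain ⟨f, rfl⟩ := truncMk_surjective q x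
  let mon : (σ → Fin q) → (σ →₀ ℕ) := fun k => Finsupp.equivFunOnFinite.symm fun s => (k s : ℕ)
  have hf : truncMk q f = truncMk q (∑ k : σ → Fin q, MvPowerSeries.coeff (mon k) f •
      MvPowerSeries.monomial (mon k) (1 : F)) := by
    rw [← sub_eq_zero, ← map_sub, truncMk_eq_zero, mem_varPowIdeal_iff]
    intro m hm
    have hm' : m = mon fun s => ⟨m s, hm s⟩ := by
      ext s
      simp [mon]
    have hinj : Function.Injective mon := by
      intro k l hkl
      ext s
      simpa [mon] using DFunLike.congr_fun hkl s
    rw [map_sub, map_sum, sub_eq_zero, Finset.sum_eq_single fun s => ⟨m s, hm s⟩]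
    · rw [← hm']
      simp
    · intro k _ hk
      rw [map_smul, MvPowerSeries.coeff_monomial, if_neg, smul_zero]
      intro h
      exact hk (hinj (h.symm.trans hm'))
    · simp
  rw [hf, map_sum]
  refine Submodule.sum_mem _ fun k _ => ?_
  rw [map_smul, monomial_eq_prod_X_pow]
  exact p.smul_mem _ (h _)

/-- Multiplication by `f` on the truncated power series ring. -/
noncomputable def truncMul (q : ℕ) (f : MvPowerSeries σ F) : Module.End F (TruncSeries σ F q) :=
  LinearMap.mulLeft F (truncMk q f)

theorem truncMul_truncMk (q : ℕ) (f g : MvPowerSeries σ F) :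
    truncMul q f (truncMk q g) = truncMk q (f * g) :=
  (map_mul _ _ _).symm

theorem truncMul_pow (q : ℕ) (f : MvPowerSeries σ F) (n : ℕ) :
    truncMul q f ^ n = truncMul q (f ^ n) := by
  rw [truncMul, LinearMap.pow_mulLeft, ← map_pow, truncMul]

theorem hilbertKunz_eq_corank (p : ℕ) (f : MvPowerSeries σ F) (n : ℕ) :
    hilbertKunz p f n = corank (truncMul (p ^ n) f) := by
  let L : MvPowerSeries σ F →ₗ[F] TruncSeries σ F (p ^ n) ⧸ LinearMap.range (truncMul (p ^ n) f) :=
    (Submodule.mkQ _) ∘ₗ (truncMk (p ^ n)).toLinearMap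
  have hL : Function.Surjective L := (Submodule.mkQ_surjective _).comp (truncMk_surjective _)
  have hker : LinearMap.ker L = (hilbertKunzIdeal p f n).restrictScalars F := by
    ext h
    rw [LinearMap.mem_ker, Submodule.restrictScalars_mem, hilbertKunzIdeal, Ideal.mem_span_insert]
    change Submodule.Quotient.mk (truncMk (p ^ n) h) = 0 ↔ _
    rw [Submodule.Quotient.mk_eq_zero, LinearMap.mem_range]
    constructor
    · rintro ⟨x, hx⟩
      obtain ⟨a, rfl⟩ := truncMk_surjective _ x
      rw [truncMul_truncMk, eq_comm, ← sub_eq_zero, ← map_sub, truncMk_eq_zero] at hx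
      exact ⟨a, _, hx, by ring⟩
    · rintro ⟨a, z, hz, rfl⟩
      refine ⟨truncMk _ a, ?_⟩
      rw [truncMul_truncMk, map_add, truncMk_eq_zero.mpr hz, add_zero, mul_comm]
  exact ((Submodule.Quotient.restrictScalarsEquiv F (hilbertKunzIdeal p f n)).symm ≪≫ₗ
    Submodule.quotEquivOfEq _ _ hker.symm ≪≫ₗ LinearMap.quotKerEquivOfSurjective _ hL).finrank_eq

/-- A zero constant term puts g in the ideal (x_s), which the iterated Frobenius carries into
(x_s^(2^n)). -/
theorem truncMul_pow_eq_zero [CharP F 2] [Finite σ] {g : MvPowerSeries σ F}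
    (hg : MvPowerSeries.constantCoeff g = 0) (n : ℕ) : truncMul (2 ^ n) g ^ 2 ^ n = 0 := by
  have : CharP (MvPowerSeries σ F) 2 :=
    charP_of_injective_algebraMap (algebraMap F (MvPowerSeries σ F)).injective 2
  have hg' : g ∈ varPowIdeal σ F 1 := by
    rw [mem_varPowIdeal_iff]
    intro m hm
    have : m = 0 := by
      ext s
      simpa using hm s
    rw [this]
    simpa using hg
  have hle : varPowIdeal σ F 1 ≤
      (varPowIdeal σ F (2 ^ n)).comap (iterateFrobenius (MvPowerSeries σ F) 2 n) := by
    refine Ideal.span_le.mpr ?_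
    rintro _ ⟨s, rfl⟩
    refine Ideal.subset_span ⟨s, ?_⟩
    simp [iterateFrobenius_def]
  have h : g ^ 2 ^ n ∈ varPowIdeal σ F (2 ^ n) := hle hg'
  rw [truncMul_pow, truncMul, truncMk_eq_zero.mpr h, LinearMap.mulLeft_zero_eq_zero]

end TruncSeries

/-! ### Disjoint variables and tensor products -/

section Rename

variable {σ τ υ F : Type*} [Field F]

theorem varPowIdeal_le_comap_rename [Finite σ] (j : σ → υ) (q : ℕ) :
    varPowIdeal σ F q ≤ (varPowIdeal υ F q).comap (MvPowerSeries.rename j) := by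
  refine Ideal.span_le.mpr ?_
  rintro _ ⟨s, rfl⟩
  refine Ideal.subset_span ⟨j s, ?_⟩
  simp

/-- Renaming of variables in truncated power series. -/
noncomputable def truncRename (F : Type*) [Field F] [Finite σ] (j : σ → υ) (q : ℕ) :
    TruncSeries σ F q →ₐ[F] TruncSeries υ F q :=
  Ideal.quotientMapₐ _ (MvPowerSeries.rename j) (varPowIdeal_le_comap_rename j q)

theorem truncRename_truncMk [Finite σ] (j : σ → υ) (q : ℕ) (f : MvPowerSeries σ F) :
    truncRename F j q (truncMk q f) = truncMk q (MvPowerSeries.rename j f) := rfl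

/-- The image is a subalgebra containing all the variables, hence everything, and the dimensions
agree. -/
theorem truncProduct_bijective [Fintype σ] [Fintype τ] [Fintype υ] (j : σ → υ) (k : τ → υ)
    (h : Function.Bijective (Sum.elim j k)) (q : ℕ) : Function.Bijective
      (Algebra.TensorProduct.productMap (truncRename F j q) (truncRename F k q)) := by
  set P := Algebra.TensorProduct.productMap (truncRename F j q) (truncRename F k q)
  have hfin : Module.finrank F (TruncSeries σ F q ⊗[F] TruncSeries τ F q) =
      Module.finrank F (TruncSeries υ F q) := by
    rw [Module.finrank_tensorProduct, finrank_truncSeries, finrank_truncSeries,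
      finrank_truncSeries, ← pow_add, ← Fintype.card_sum, Fintype.card_of_bijective h]
  have hsurj : Function.Surjective P.toLinearMap := by
    rw [← LinearMap.range_eq_top]
    refine eq_top_of_prod_X_pow_mem fun m => ?_
    change _ ∈ P.range
    rw [map_prod]
    refine Subalgebra.prod_mem _ fun t _ => ?_
    rw [map_pow]
    refine Subalgebra.pow_mem _ ?_ _
    obtain ⟨s | s, rfl⟩ := h.2 t
    · refine ⟨truncMk q (MvPowerSeries.X s) ⊗ₜ 1, ?_⟩
      change P _ = _
      rw [Algebra.TensorProduct.productMap_apply_tmul, map_one, mul_one, truncRename_truncMk,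
        MvPowerSeries.rename_X]
      rfl
    · refine ⟨1 ⊗ₜ truncMk q (MvPowerSeries.X s), ?_⟩
      change P _ = _
      rw [Algebra.TensorProduct.productMap_apply_tmul, map_one, one_mul, truncRename_truncMk,
        MvPowerSeries.rename_X]
      rfl
  exact ⟨(LinearMap.injective_iff_surjective_of_finrank_eq_finrank hfin).mpr hsurj, hsurj⟩

/-- The truncated power series ring in a disjoint union of two sets of variables. -/
noncomputable def truncProductEquiv (F : Type*) [Field F] [Fintype σ] [Fintype τ] [Fintype υ]
    (j : σ → υ) (k : τ → υ) (h : Function.Bijective (Sum.elim j k)) (q : ℕ) :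
    (TruncSeries σ F q ⊗[F] TruncSeries τ F q) ≃ₗ[F] TruncSeries υ F q :=
  LinearEquiv.ofBijective _ (truncProduct_bijective (F := F) j k h q)

theorem truncProductEquiv_tensorSum [Fintype σ] [Fintype τ] [Fintype υ] (j : σ → υ) (k : τ → υ)
    (h : Function.Bijective (Sum.elim j k)) (q : ℕ) (f : MvPowerSeries σ F)
    (g : MvPowerSeries τ F) (x : TruncSeries σ F q ⊗[F] TruncSeries τ F q) :
    truncProductEquiv F j k h q (tensorSum (truncMul q f) (truncMul q g) x) =
      truncMul q (MvPowerSeries.rename j f + MvPowerSeries.rename k g)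
        (truncProductEquiv F j k h q x) := by
  induction x with
  | zero => rw [LinearMap.map_zero, LinearEquiv.map_zero, LinearMap.map_zero]
  | add x y hx hy =>
    rw [LinearMap.map_add, LinearEquiv.map_add, LinearEquiv.map_add, LinearMap.map_add, hx, hy]
  | tmul x y =>
    obtain ⟨x, rfl⟩ := truncMk_surjective q x
    obtain ⟨y, rfl⟩ := truncMk_surjective q y
    have htmul (x : MvPowerSeries σ F) (y : MvPowerSeries τ F) :
        truncProductEquiv F j k h q (truncMk q x ⊗ₜ truncMk q y) =
          truncMk q (MvPowerSeries.rename j x * MvPowerSeries.rename k y) :=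
      (Algebra.TensorProduct.productMap_apply_tmul _ _ _ _).trans
        (map_mul (truncMk q) (MvPowerSeries.rename j x) (MvPowerSeries.rename k y)).symm
    rw [tensorSum_tmul, LinearEquiv.map_add, truncMul_truncMk, truncMul_truncMk, htmul, htmul, htmul,
      truncMul_truncMk, ← map_add, map_mul, map_mul]
    congr 1
    ring

end Rename

/-! ### Frobenius and the passage from level q to level 2q -/

section Frobenius

theorem corank_baseChange {F K V : Type*} [Field F] [Field K] [Algebra F K] [AddCommGroup V]
    [Module F V] (T : Module.End F V) :
    corank (T.baseChange K : Module.End K (K ⊗[F] V)) = corank T := by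
  set p := (LinearMap.range T).mkQ.baseChange K
  have hp : Function.Surjective p :=
    LinearMap.lTensor_surjective K (Submodule.mkQ_surjective (LinearMap.range T))
  have hex : Function.Exact (LinearMap.lTensor K T) (LinearMap.lTensor K (LinearMap.range T).mkQ) :=
    lTensor_exact K (LinearMap.exact_map_mkQ_range T) (Submodule.mkQ_surjective _)
  have hker : LinearMap.ker p = LinearMap.range (T.baseChange K) := by
    ext x
    exact hex x
  rw [corank, ← hker, (LinearMap.quotKerEquivOfSurjective p hp).finrank_eq,
    Module.finrank_baseChange]
  rfl

variable {σ F K : Type*} [Field F] [Field K]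

theorem varPowIdeal_le_comap_of_X_sq [Algebra F K]
    (ψ : MvPowerSeries σ F →ₐ[F] MvPowerSeries σ K)
    (hψ : ∀ s, ψ (MvPowerSeries.X s) = MvPowerSeries.X s ^ 2) (q : ℕ) :
    varPowIdeal σ F q ≤ (varPowIdeal σ K (2 * q)).comap ψ := by
  refine Ideal.span_le.mpr ?_
  rintro _ ⟨s, rfl⟩
  refine Ideal.subset_span ⟨s, ?_⟩
  simp [hψ, pow_mul]

variable [Fintype σ]

/-- K[[x]]/(x_s^(2q)) is free over K ⊗ F[[x]]/(x_s^q), embedded by x_s ↦ x_s^2, on the 2^r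
squarefree monomials. On each summand ψ(h) acts as the base change of h. Base change preserves
corank, so no condition on the degree of K over F enters. -/
theorem corank_truncMul_of_X_sq_algHom [Algebra F K]
    (ψ : MvPowerSeries σ F →ₐ[F] MvPowerSeries σ K)
    (hψ : ∀ s, ψ (MvPowerSeries.X s) = MvPowerSeries.X s ^ 2) (q : ℕ) (h : MvPowerSeries σ F) :
    corank (truncMul (2 * q) (ψ h)) = 2 ^ Fintype.card σ * corank (truncMul q h) := by
  classical
  let Ψ : TruncSeries σ F q →ₐ[F] TruncSeries σ K (2 * q) :=
    Ideal.quotientMapₐ _ ψ (varPowIdeal_le_comap_of_X_sq ψ hψ q)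
  have hΨ (f : MvPowerSeries σ F) : Ψ (truncMk q f) = truncMk (2 * q) (ψ f) := rfl
  let P : K ⊗[F] TruncSeries σ F q →ₐ[K] TruncSeries σ K (2 * q) :=
    Algebra.TensorProduct.lift (Algebra.ofId K _) Ψ fun _ _ => Commute.all _ _
  have hP (a : K) (x : TruncSeries σ F q) : P (a ⊗ₜ x) = a • Ψ x :=
    (Algebra.TensorProduct.lift_tmul _ _ _ _ _).trans (Algebra.smul_def _ _).symm
  let x : (σ → Fin 2) → MvPowerSeries σ K := fun ε => ∏ s, MvPowerSeries.X s ^ (ε s : ℕ)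
  let L : ((σ → Fin 2) → K ⊗[F] TruncSeries σ F q) →ₗ[K] TruncSeries σ K (2 * q) :=
    ∑ ε, LinearMap.mulLeft K (truncMk (2 * q) (x ε)) ∘ₗ P.toLinearMap ∘ₗ LinearMap.proj ε
  have hL (v) : L v = ∑ ε, truncMk (2 * q) (x ε) * P (v ε) := by
    simp [L]
  have hfin : Module.finrank K ((σ → Fin 2) → K ⊗[F] TruncSeries σ F q) =
      Module.finrank K (TruncSeries σ K (2 * q)) := by
    rw [Module.finrank_pi_fintype, Finset.sum_const, Module.finrank_baseChange,
      finrank_truncSeries, finrank_truncSeries, Finset.card_univ, Fintype.card_fun,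
      Fintype.card_fin, smul_eq_mul, mul_pow]
  have hsurj : Function.Surjective L := by
    rw [← LinearMap.range_eq_top]
    refine eq_top_of_prod_X_pow_mem fun m => ?_
    -- Each exponent is written as m s % 2 + 2 * (m s / 2): the remainder selects the basis
    -- monomial, the quotient comes from the smaller ring.
    refine ⟨Pi.single (fun s => ⟨m s % 2, Nat.mod_lt _ two_pos⟩)
      (1 ⊗ₜ truncMk q (∏ s, MvPowerSeries.X s ^ (m s / 2))), ?_⟩
    rw [hL, Finset.sum_eq_single fun s => ⟨m s % 2, Nat.mod_lt _ two_pos⟩]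
    · rw [Pi.single_eq_same, hP, one_smul, hΨ, ← map_mul, map_prod, ← Finset.prod_mul_distrib]
      congr 1
      refine Finset.prod_congr rfl fun s _ => ?_
      rw [map_pow, hψ, ← pow_mul, ← pow_add, Nat.mod_add_div]
    · intro ε _ hε
      rw [Pi.single_eq_of_ne hε, map_zero, mul_zero]
    · simp
  have hbij : Function.Bijective L :=
    ⟨(LinearMap.injective_iff_surjective_of_finrank_eq_finrank hfin).mpr hsurj, hsurj⟩
  have hPT (y : K ⊗[F] TruncSeries σ F q) :
      P ((truncMul q h).baseChange K y) = truncMk (2 * q) (ψ h) * P y := by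
    induction y with
    | zero => simp
    | add y z hy hz => rw [map_add, map_add, map_add, hy, hz, mul_add]
    | tmul a y =>
      rw [LinearMap.baseChange_tmul, hP, hP, mul_smul_comm, ← hΨ, ← map_mul]
      rfl
  rw [← corank_baseChange (K := K) (truncMul q h)]
  trans corank (LinearMap.pi fun ε => (truncMul q h).baseChange K ∘ₗ LinearMap.proj ε :
    Module.End K ((σ → Fin 2) → K ⊗[F] TruncSeries σ F q))
  · symm
    refine corank_congr (LinearEquiv.ofBijective L hbij) fun v => ?_
    rw [LinearEquiv.ofBijective_apply, LinearEquiv.ofBijective_apply, hL, hL]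
    change _ = truncMk (2 * q) (ψ h) * _
    rw [Finset.mul_sum]
    refine Finset.sum_congr rfl fun ε _ => ?_
    rw [mul_left_comm, ← hPT]
    rfl
  · rw [corank_pi, Finset.sum_const, Finset.card_univ, Fintype.card_fun, Fintype.card_fin,
      smul_eq_mul]

/-- With K distinct from F, the algebra structure can come from φ; taking φ to be Frobenius on F
then causes no clash with F as an algebra over itself. -/
theorem corank_truncMul_of_X_sq (φ : F →+* K) (ψ : MvPowerSeries σ F →+* MvPowerSeries σ K)
    (hφ : ∀ a, ψ (MvPowerSeries.C a) = MvPowerSeries.C (φ a))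
    (hψ : ∀ s, ψ (MvPowerSeries.X s) = MvPowerSeries.X s ^ 2) (q : ℕ) (h : MvPowerSeries σ F) :
    corank (truncMul (2 * q) (ψ h)) = 2 ^ Fintype.card σ * corank (truncMul q h) :=
  letI := φ.toAlgebra
  corank_truncMul_of_X_sq_algHom (K := K)
    { ψ with
      commutes' := fun a => by
        change ψ (algebraMap F (MvPowerSeries σ F) a) = algebraMap F (MvPowerSeries σ K) a
        rw [MvPowerSeries.algebraMap_apply, MvPowerSeries.algebraMap_apply]
        exact hφ a } hψ q h

theorem corank_truncMul_sq [CharP F 2] (q : ℕ) (h : MvPowerSeries σ F) :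
    corank (truncMul (2 * q) (h ^ 2)) = 2 ^ Fintype.card σ * corank (truncMul q h) := by
  have : CharP (MvPowerSeries σ F) 2 :=
    charP_of_injective_algebraMap (algebraMap F (MvPowerSeries σ F)).injective 2
  exact corank_truncMul_of_X_sq (frobenius F 2) (frobenius (MvPowerSeries σ F) 2)
    (fun a => (map_pow MvPowerSeries.C a 2).symm) (fun s => rfl) q h

/-- Apply `corank_truncMul_sq` to g^b and g^(b+1) and subtract. -/
theorem jump_truncMul [CharP F 2] (q : ℕ) (g : MvPowerSeries σ F) (b : ℕ) :
    2 ^ Fintype.card σ * jump (truncMul q g) b =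
      jump (truncMul (2 * q) g) (2 * b) + jump (truncMul (2 * q) g) (2 * b + 1) := by
  have h (b : ℕ) : corank (truncMul (2 * q) g ^ (2 * b)) =
      2 ^ Fintype.card σ * corank (truncMul q g ^ b) := by
    rw [truncMul_pow, truncMul_pow, mul_comm 2 b, pow_mul, corank_truncMul_sq]
  have h0 := h b
  have h1 := h (b + 1)
  rw [mul_add, mul_one] at h1
  zify at h0 h1
  rw [jump, jump, jump]
  linear_combination h0 - h1

end Frobenius

/-! ### The Jordan type of uv -/

section Hyperbolic

variable {σ F : Type*} [Field F] [Fintype σ]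

/-- Multiplication by this monomial raises every exponent by i, so exactly the series in (x_s^(q-i))
are sent to zero. -/
theorem finrank_range_truncMul_prod_X_pow (q i : ℕ) :
    Module.finrank F (LinearMap.range (truncMul q
      ((∏ s, MvPowerSeries.X s : MvPowerSeries σ F)) ^ i)) = (q - i) ^ Fintype.card σ := by
  classical
  rw [truncMul_pow]
  set T := truncMul q ((∏ s, MvPowerSeries.X s : MvPowerSeries σ F) ^ i)
  let n : σ →₀ ℕ := Finsupp.equivFunOnFinite.symm fun _ => i
  have hn : (∏ s, MvPowerSeries.X s : MvPowerSeries σ F) ^ i = MvPowerSeries.monomial n 1 := by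
    rw [monomial_eq_prod_X_pow, ← Finset.prod_pow]
    rfl
  let L : MvPowerSeries σ F →ₗ[F] TruncSeries σ F q := T ∘ₗ (truncMk q).toLinearMap
  have hrange : LinearMap.range T = LinearMap.range L :=
    (LinearMap.range_comp_of_range_eq_top _
      (LinearMap.range_eq_top.mpr (truncMk_surjective q))).symm
  have hker : LinearMap.ker L = (varPowIdeal σ F (q - i)).restrictScalars F := by
    ext f
    rw [LinearMap.mem_ker, Submodule.restrictScalars_mem, mem_varPowIdeal_iff]
    change T (truncMk q f) = 0 ↔ _
    rw [truncMul_truncMk, truncMk_eq_zero, mem_varPowIdeal_iff, hn]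
    constructor
    · intro h m hm
      have := h (n + m) fun s => by
        have := hm s
        simp only [Finsupp.add_apply, n, Finsupp.equivFunOnFinite_symm_apply_apply]
        omega
      rwa [MvPowerSeries.coeff_add_monomial_mul, one_mul] at this
    · intro h m hm
      rw [MvPowerSeries.coeff_monomial_mul]
      split_ifs with hle
      · rw [one_mul]
        refine h _ fun s => ?_
        have h1 := hm s
        have h2 := hle s
        simp only [Finsupp.tsub_apply, n, Finsupp.equivFunOnFinite_symm_apply_apply] at h2 ⊢
        omega
      · rfl
  rw [hrange, ← (LinearMap.quotKerEquivRange L).finrank_eq, ← finrank_truncSeries (F := F)]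
  exact ((Submodule.Quotient.restrictScalarsEquiv F (varPowIdeal σ F (q - i))).symm ≪≫ₗ
    Submodule.quotEquivOfEq _ _ hker.symm).finrank_eq.symm

theorem jump_truncMul_mul (q b : ℕ) (hb : b < q) :
    jump (truncMul q (MvPowerSeries.X 0 * MvPowerSeries.X 1 : MvPowerSeries (Fin 2) F)) b =
      2 * (q - b) - 1 := by
  have hprod : (MvPowerSeries.X 0 * MvPowerSeries.X 1 : MvPowerSeries (Fin 2) F) =
      ∏ s, MvPowerSeries.X s := by simp
  have h (i : ℕ) (hi : i ≤ q) : (corank (truncMul q (MvPowerSeries.X 0 * MvPowerSeries.X 1 :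
      MvPowerSeries (Fin 2) F) ^ i) : ℤ) = q ^ 2 - (q - i) ^ 2 := by
    have := corank_add_finrank_range (truncMul q (MvPowerSeries.X 0 * MvPowerSeries.X 1 :
      MvPowerSeries (Fin 2) F) ^ i)
    rw [finrank_truncSeries, hprod, finrank_range_truncMul_prod_X_pow, ← hprod, Fintype.card_fin]
      at this
    zify [hi] at this
    linarith
  rw [jump, h _ hb, h _ hb.le]
  push_cast
  ring

end Hyperbolic

/-! ### Coefficients of θ and the product formula -/

section Theta

variable {F : Type*} [Field F]

theorem hilbertKunz_uvAdd [CharP F 2] {σ : Type*} [Fintype σ] (g : MvPowerSeries σ F) (n : ℕ) :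
    (hilbertKunz 2 (uvAdd g) n : ℤ) =
      ∑ b ∈ Finset.range (2 ^ n), (2 * (2 ^ n - b) - 1) * jump (truncMul (2 ^ n) g) b := by
  set U := truncMul (2 ^ n) (MvPowerSeries.X 0 * MvPowerSeries.X 1 : MvPowerSeries (Fin 2) F)
  have hU : U ^ 2 ^ n = 0 := truncMul_pow_eq_zero (by simp) n
  have huv : uvAdd g = MvPowerSeries.rename Sum.inl g +
      MvPowerSeries.rename Sum.inr (MvPowerSeries.X 0 * MvPowerSeries.X 1) := by
    rw [uvAdd, map_mul, MvPowerSeries.rename_X, MvPowerSeries.rename_X, add_comm]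
  have hbij : Function.Bijective
      (Sum.elim Sum.inl Sum.inr : σ ⊕ Fin 2 → σ ⊕ Fin 2) := by
    rw [Sum.elim_inl_inr]
    exact Function.bijective_id
  rw [hilbertKunz_eq_corank, huv, ← corank_congr (truncProductEquiv F Sum.inl Sum.inr hbij (2 ^ n))
    (truncProductEquiv_tensorSum _ _ hbij _ _ _), corank_tensorSum_eq_sum_jump hU]
  refine Finset.sum_congr rfl fun b hb => ?_
  rw [jump_truncMul_mul _ _ (Finset.mem_range.mp hb)]
  push_cast
  ring

theorem coeff_thetaSeries [CharP F 2] {σ : Type*} [Fintype σ] (g : MvPowerSeries σ F) (n : ℕ) :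
    PowerSeries.coeff n (thetaSeries g) = oddBlocks (2 ^ n) (truncMul (2 ^ n) g) := by
  rw [thetaSeries, sub_mul, one_mul, mul_assoc, map_sub, PowerSeries.coeff_C_mul,
    PowerSeries.coeff_mk]
  cases n with
  | zero =>
    rw [PowerSeries.coeff_zero_X_mul, hilbertKunz_uvAdd]
    simp [oddBlocks]
  | succ n =>
    rw [PowerSeries.coeff_succ_X_mul, PowerSeries.coeff_mk, hilbertKunz_uvAdd, hilbertKunz_uvAdd,
      pow_succ' 2 n, oddBlocks_two_mul, Finset.mul_sum]
    have hsum (f : ℕ → ℤ) (m : ℕ) : ∑ b ∈ Finset.range (2 * m), f b =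
        ∑ b ∈ Finset.range m, (f (2 * b) + f (2 * b + 1)) := by
      induction m with
      | zero => simp
      | succ m ih =>
        rw [show 2 * (m + 1) = 2 * m + 1 + 1 by ring, Finset.sum_range_succ,
          Finset.sum_range_succ, Finset.sum_range_succ, ih, add_assoc]
    rw [hsum, ← Finset.sum_sub_distrib]
    refine Finset.sum_congr rfl fun b _ => ?_
    -- With q = 2^n, the weights at 2b and 2b + 1 for level 2q are 4(q - b) - 1 and 4(q - b) - 3.
    -- They differ by +1 and -1 from twice the weight 2(q - b) - 1 at b, leaving exactly jump(2b) -
    -- jump(2b + 1).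
    have := jump_truncMul (2 ^ n) g b
    push_cast
    rw [pow_succ 2 (Fintype.card σ), pow_succ' 2 n]
    linear_combination (-2 * (2 * (2 ^ n - (b : ℤ)) - 1)) * this

theorem oddBlocks_truncMul_rename_add [CharP F 2] {σ τ υ : Type*} [Fintype σ] [Fintype τ]
    [Fintype υ] (j : σ → υ) (k : τ → υ) (h : Function.Bijective (Sum.elim j k))
    {f : MvPowerSeries σ F} {g : MvPowerSeries τ F} (hf : MvPowerSeries.constantCoeff f = 0)
    (hg : MvPowerSeries.constantCoeff g = 0) (n : ℕ) :
    oddBlocks (2 ^ n) (truncMul (2 ^ n) (MvPowerSeries.rename j f + MvPowerSeries.rename k g)) =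
      oddBlocks (2 ^ n) (truncMul (2 ^ n) f) * oddBlocks (2 ^ n) (truncMul (2 ^ n) g) := by
  rw [← oddBlocks_tensorSum (truncMul_pow_eq_zero hf n) (truncMul_pow_eq_zero hg n),
    oddBlocks_congr (truncProductEquiv F j k h (2 ^ n)) (truncProductEquiv_tensorSum j k h _ f g)]

/-- Without variables the ring is F itself, and zero acts as one block of size 1; this is the empty
product. -/
theorem oddBlocks_truncMul_zero_of_isEmpty {υ : Type*} [Fintype υ] [IsEmpty υ] (n : ℕ) :
    oddBlocks (2 ^ n) (truncMul (2 ^ n) (0 : MvPowerSeries υ F)) = 1 := by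
  have h0 : truncMul (2 ^ n) (0 : MvPowerSeries υ F) ^ 1 = 0 := by
    rw [pow_one, truncMul, map_zero, LinearMap.mulLeft_zero_eq_zero]
  rw [oddBlocks_eq_of_le h0 Nat.one_le_two_pow, oddBlocks]
  simp only [Finset.range_one, Finset.sum_singleton, jump, zero_add, h0, pow_zero, corank_one,
    corank_zero, finrank_truncSeries]
  simp

universe u v

/-- Allowing any variable set υ in bijection with the disjoint union makes the claim stable under
reindexing ι and under splitting off one summand, as the induction requires. -/
theorem oddBlocks_truncMul_sum_rename [CharP F 2] (n : ℕ) (ι : Type u) [Fintype ι] :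
    ∀ (σ : ι → Type v) [∀ i, Fintype (σ i)] (υ : Type (max u v)) [Fintype υ]
      (j : ∀ i, σ i → υ) (_ : Function.Bijective fun x : Σ i, σ i => j x.1 x.2)
      (g : ∀ i, MvPowerSeries (σ i) F) (_ : ∀ i, MvPowerSeries.constantCoeff (g i) = 0),
      oddBlocks (2 ^ n) (truncMul (2 ^ n) (∑ i, MvPowerSeries.rename (j i) (g i))) =
        ∏ i, oddBlocks (2 ^ n) (truncMul (2 ^ n) (g i)) := by
  refine Fintype.induction_empty_option (P := fun ι _ => ∀ (σ : ι → Type v) [∀ i, Fintype (σ i)]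
    (υ : Type (max u v)) [Fintype υ] (j : ∀ i, σ i → υ)
    (_ : Function.Bijective fun x : Σ i, σ i => j x.1 x.2) (g : ∀ i, MvPowerSeries (σ i) F)
    (_ : ∀ i, MvPowerSeries.constantCoeff (g i) = 0),
    oddBlocks (2 ^ n) (truncMul (2 ^ n) (∑ i, MvPowerSeries.rename (j i) (g i))) =
      ∏ i, oddBlocks (2 ^ n) (truncMul (2 ^ n) (g i))) ?_ ?_ ?_ ι
  · intro α β _ e ih σ _ υ _ j hj g hg
    let := Fintype.ofEquiv β e.symm
    rw [← e.sum_comp, ← e.prod_comp]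
    exact ih (fun a => σ (e a)) υ (fun a => j (e a))
      (hj.comp (Equiv.sigmaCongrLeft e).bijective) (fun a => g (e a)) fun a => hg (e a)
  · intro σ _ υ _ j hj g hg
    have : IsEmpty υ := ⟨fun x => by
      obtain ⟨y, -⟩ := hj.2 x
      exact y.1.elim⟩
    rw [Finset.univ_eq_empty, Finset.sum_empty, Finset.prod_empty,
      oddBlocks_truncMul_zero_of_isEmpty]
  · intro α _ ih σ _ υ _ j hj g hg
    let j' : ∀ a, σ (some a) → Σ a, σ (some a) := fun a x => ⟨a, x⟩
    have hj' : Function.Bijective fun x : Σ a, σ (some a) => j' x.1 x.2 := Function.bijective_id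
    rw [Fintype.sum_option, Fintype.prod_option,
      ← ih (fun a => σ (some a)) (Σ a, σ (some a)) j' hj' (fun a => g (some a))
        fun a => hg (some a),
      ← oddBlocks_truncMul_rename_add (j none)
        (fun x : Σ a, σ (some a) => j (some x.1) x.2) ?_ (hg none) ?_, map_sum]
    · simp_rw [MvPowerSeries.rename_rename]
      rfl
    · constructor
      · rintro (x | ⟨a, x⟩) (y | ⟨b, y⟩) hxy
        · have := hj.1 (a₁ := ⟨none, x⟩) (a₂ := ⟨none, y⟩) hxy
          simpa using this
        · have := hj.1 (a₁ := ⟨none, x⟩) (a₂ := ⟨some b, y⟩) hxy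
          simp at this
        · have := hj.1 (a₁ := ⟨some a, x⟩) (a₂ := ⟨none, y⟩) hxy
          simp at this
        · have := hj.1 (a₁ := ⟨some a, x⟩) (a₂ := ⟨some b, y⟩) hxy
          simp only [Sigma.mk.injEq, Option.some.injEq] at this
          obtain ⟨rfl, h⟩ := this
          rw [eq_of_heq h]
      · intro t
        obtain ⟨⟨_ | a, x⟩, rfl⟩ := hj.2 t
        · exact ⟨Sum.inl x, rfl⟩
        · exact ⟨Sum.inr ⟨a, x⟩, rfl⟩
    · simp [hg]

end Theta

theorem theorem1p6 {F : Type*} [Field F] [CharP F 2] {ι : Type*} [Fintype ι]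
    (σ : ι → Type*) [∀ i, Fintype (σ i)] (g : ∀ i, MvPowerSeries (σ i) F)
    (hg : ∀ i, MvPowerSeries.constantCoeff (g i) = 0) :
    thetaSeries (disjointSum g) = hadamardProd fun i => thetaSeries (g i) := by
  ext n
  rw [hadamardProd, PowerSeries.coeff_mk, coeff_thetaSeries]
  simp_rw [coeff_thetaSeries]
  exact oddBlocks_truncMul_sum_rename n ι σ (Σ i, σ i) (fun i => Sigma.mk i)
    Function.bijective_id g hg
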